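/- A lattice polygon is the convex hull in $\mathbb{R}^2$ of a non-empty finite subset of $\mathbb{Z}^2$ (segments are allowed). Two lattice polygons $P,Q$ are lattice equivalent if $Q=\{Mx+t : x\in P\}$ for some integer $2\times 2$ matrix $M$ with $\det M=\pm1$ and some $t\in\mathbb{Z}^2$. For a finite field $\mathbb{F}_q$ and a lattice polygon $P$, let $C_P(\mathbb{F}_q)\subseteq\mathbb{F}_q^{(q-1)^2}$ be the row space of the matrix $(a^p)$ with rows indexed by $p\in P\cap\mathbb{Z}^2$ and columns indexed by $a\in(\mathbb{F}_q^*)^2$, where $a^p=a_1^{p_1}a_2^{p_2}$. A toric surface code over $\mathbb{F}_q$ is a code $C_P(\mathbb{F}_q)$ with $P\subseteq[0,q-2]^2$. Two codes of length $n$ and dimension $k$ over $\mathbb{F}_q$ are monomially equivalent if they have $k\times n$ generator matrices $G_1,G_2$ with $G_2=G_1\Delta\Pi$ for some invertible diagonal matrix $\Delta$ and some permutation matrix $\Pi$. Let $P_7^{(1)},\dots,P_7^{(22)}$ be the convex hulls of the following sets: 1. $(0,0),(6,0)$ 2. $(0,0),(5,0),(0,1)$ 3. $(0,0),(4,0),(1,1),(0,1)$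 4. $(0,0),(3,0),(2,1),(0,1)$ 5. $(0,0),(2,0),(2,1),(0,2)$ 6. $(0,0),(2,0),(2,1),(1,2),(0,1)$ 7. $(-1,-1),(0,-1),(1,0),(1,1),(0,1),(-1,0)$ 8. $(0,0),(3,0),(1,2)$ 9. $(-1,-1),(0,-1),(2,0),(-1,1)$ 10. $(-1,0),(0,-1),(1,-1),(2,0),(-1,1)$ 11. $(0,0),(2,-1),(3,-1),(3,0),(0,1)$ 12. $(-1,0),(0,-1),(2,-1),(1,1)$ 13. $(-1,0),(1,-1),(2,-1),(1,1),(0,1)$ 14. $(-1,0),(3,-1),(3,0),(-1,1)$ 15. $(-1,0),(2,-1),(3,0),(-1,1)$ 16. $(-1,0),(1,-1),(3,0),(-1,1)$ 17. $(-1,0),(0,-1),(3,0),(-1,1)$ 18. $(-1,-1),(3,0),(-1,1)$ 19. $(0,-1),(3,0),(0,1),(-1,1)$ 20. $(-1,-1),(2,0),(0,2)$ 21. $(0,-1),(2,0),(1,1),(-1,2)$ 22. $(-2,-1),(3,0),(-1,1)$ Theorem. Each $P_7^{(i)}$ has exactly $7$ lattice points, and the $22$ polygons are pairwise lattice inequivalent.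 Every lattice polygon with exactly $7$ lattice points is lattice equivalent to one of $P_7^{(1)},\dots,P_7^{(22)}$. For every finite field $\mathbb{F}_q$, every toric surface code over $\mathbb{F}_q$ of dimension $k=7$ is monomially equivalent to $C_{P_7^{(i)}}(\mathbb{F}_q)$ for some $i\in\{1,\dots,22\}$. -/

import Mathlib

/-- The inclusion of the lattice `ℤ²` in the plane `ℝ²`. -/
def toPlane (v : Fin 2 → ℤ) : Fin 2 → ℝ := fun i => (v i : ℝ)

/-- A lattice polygon: the convex hull of a non-empty finite set of lattice points of the plane.
Degenerate polygons (points and segments) are allowed. -/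
def IsLatticePolygon (P : Set (Fin 2 → ℝ)) : Prop :=
  ∃ S : Finset (Fin 2 → ℤ), S.Nonempty ∧ P = convexHull ℝ (toPlane '' (S : Set (Fin 2 → ℤ)))

/-- The lattice points `P ∩ ℤ²` (boundary points included). -/
def latticePoints (P : Set (Fin 2 → ℝ)) : Set (Fin 2 → ℤ) :=
  {v | toPlane v ∈ P}

/-- Lattice equivalence: `Q` is the image of `P` under an affine unimodular map
`x ↦ M x + t`, with `M` an integer matrix of determinant `±1` and `t` an integer vector. -/
def LatticeEquivalent (P Q : Set (Fin 2 → ℝ)) : Prop :=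
  ∃ (M : Matrix (Fin 2) (Fin 2) ℤ) (t : Fin 2 → ℤ), (M.det = 1 ∨ M.det = -1) ∧
    (fun x : Fin 2 → ℝ => (M.map (Int.cast : ℤ → ℝ)).mulVec x + toPlane t) '' P = Q

/-- The square `[0, q - 2]²` in the plane. -/
def square (q : ℕ) : Set (Fin 2 → ℝ) :=
  {x | ∀ i, 0 ≤ x i ∧ x i ≤ (q : ℝ) - 2}

/-- The evaluations `(a^p)` of the Laurent monomial `x^p` at all points `a` of the torus `(F^*)²`. -/
def monomialRow (F : Type*) [Field F] (p : Fin 2 → ℤ) : (Fin 2 → Fˣ) → F :=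
  fun a => ((a 0 ^ p 0 * a 1 ^ p 1 : Fˣ) : F)

/-- The code of `P` over `F`: the row space of the matrix `(a^p)` with rows indexed by
`p ∈ P ∩ ℤ²` and columns indexed by `a ∈ (F^*)²`. -/
def toricCode (F : Type*) [Field F] (P : Set (Fin 2 → ℝ)) : Submodule F ((Fin 2 → Fˣ) → F) :=
  Submodule.span F (monomialRow F '' latticePoints P)

/-- `G` is a generator matrix of the code `C`: its rows form a basis of `C`. -/
def IsGeneratorMatrix {F ι : Type*} [Field F] {k : ℕ} (G : Matrix (Fin k) ι F)
    (C : Submodule F (ι → F)) : Prop :=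
  LinearIndependent F (fun i => G i) ∧ Submodule.span F (Set.range (fun i => G i)) = C

/-- Monomial equivalence of codes with coordinates indexed by `ι`: they have generator matrices
`G₁`, `G₂` of the same size with `G₂ = G₁ Δ Π`, where `Δ` is an invertible diagonal matrix and
`Π` is a permutation matrix. -/
def MonomiallyEquivalent {F ι : Type*} [Field F] [Fintype ι] [DecidableEq ι]
    (C₁ C₂ : Submodule F (ι → F)) : Prop :=
  ∃ (k : ℕ) (G₁ G₂ : Matrix (Fin k) ι F) (d : ι → Fˣ) (π : Equiv.Perm ι),
    IsGeneratorMatrix G₁ C₁ ∧ IsGeneratorMatrix G₂ C₂ ∧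
      G₂ = G₁ * Matrix.diagonal (fun a => (d a : F)) * π.permMatrix F

/-- The vertices of the 22 polygons `P₇⁽¹⁾, …, P₇⁽²²⁾`, in this order (so the index is shifted
by one). -/
def vertices7 : Fin 22 → Finset (Fin 2 → ℤ) :=
  ![{![0, 0], ![6, 0]},
    {![0, 0], ![5, 0], ![0, 1]},
    {![0, 0], ![4, 0], ![1, 1], ![0, 1]},
    {![0, 0], ![3, 0], ![2, 1], ![0, 1]},
    {![0, 0], ![2, 0], ![2, 1], ![0, 2]},
    {![0, 0], ![2, 0], ![2, 1], ![1, 2], ![0, 1]},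
    {![-1, -1], ![0, -1], ![1, 0], ![1, 1], ![0, 1], ![-1, 0]},
    {![0, 0], ![3, 0], ![1, 2]},
    {![-1, -1], ![0, -1], ![2, 0], ![-1, 1]},
    {![-1, 0], ![0, -1], ![1, -1], ![2, 0], ![-1, 1]},
    {![0, 0], ![2, -1], ![3, -1], ![3, 0], ![0, 1]},
    {![-1, 0], ![0, -1], ![2, -1], ![1, 1]},
    {![-1, 0], ![1, -1], ![2, -1], ![1, 1], ![0, 1]},
    {![-1, 0], ![3, -1], ![3, 0], ![-1, 1]},
    {![-1, 0], ![2, -1], ![3, 0], ![-1, 1]},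
    {![-1, 0], ![1, -1], ![3, 0], ![-1, 1]},
    {![-1, 0], ![0, -1], ![3, 0], ![-1, 1]},
    {![-1, -1], ![3, 0], ![-1, 1]},
    {![0, -1], ![3, 0], ![0, 1], ![-1, 1]},
    {![-1, -1], ![2, 0], ![0, 2]},
    {![0, -1], ![2, 0], ![1, 1], ![-1, 2]},
    {![-2, -1], ![3, 0], ![-1, 1]}]

/-- The 22 polygons with seven lattice points. -/
def P7 (i : Fin 22) : Set (Fin 2 → ℝ) :=
  convexHull ℝ (toPlane '' (vertices7 i : Set (Fin 2 → ℤ)))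

/-! A lattice polygon is the convex hull of its lattice points, so up to equivalence everything is
decided by this finite set. It is `TriangleClosed`, a condition stated over ℤ alone. Deleting the
lexicographically largest point of a closed set, a vertex of its hull, leaves a closed set
(`TriangleClosed.exists_erase`). Hence the closed sets with k + 1 points arise from those with k
points by adding one point, and by induction from k = 2 every closed set with at most 7 points is
equivalent to a segment or to an entry of `reps k` (`classified_succ`). A point added to a
representative lies in an explicit box: a closed set with a unit segment at height 0 and a point at
height y has points on at least half of the heights between (`TriangleClosed.height_le`). Every
point of the box is checked by computation. A numerical invariant made of triangle areas separates
the 22 polygons. For codes, if P lies in [0, q - 2]² then its monomials are distinct characters of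
the torus, so the dimension is the number of lattice points. An affine unimodular map turns each
monomial into a fixed monomial times its pullback along an automorphism of the torus, which is a
diagonal matrix times a permutation. -/

/-! ### Affine unimodular maps of the lattice -/

/-- Twice the signed area of the triangle `abc`. -/
def area (a b c : ℤ × ℤ) : ℤ := (b.1 - a.1) * (c.2 - a.2) - (b.2 - a.2) * (c.1 - a.1)

/-- An affine unimodular map of the lattice `ℤ × ℤ`: the linear part has rows `(a, b)` and `(c, d)`,
the translation part is `(s, t)`. -/
structure UnimodularMap where
  a : ℤ
  b : ℤ
  c : ℤ
  d : ℤ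
  s : ℤ
  t : ℤ
  det_eq : a * d - b * c = 1 ∨ a * d - b * c = -1

namespace UnimodularMap

/-- The action of an affine unimodular map on lattice points. -/
def app (f : UnimodularMap) (p : ℤ × ℤ) : ℤ × ℤ :=
  (f.a * p.1 + f.b * p.2 + f.s, f.c * p.1 + f.d * p.2 + f.t)

/-- The composition `f ∘ g`. -/
def comp (f g : UnimodularMap) : UnimodularMap where
  a := f.a * g.a + f.b * g.c
  b := f.a * g.b + f.b * g.d
  c := f.c * g.a + f.d * g.c
  d := f.c * g.b + f.d * g.d
  s := f.a * g.s + f.b * g.t + f.s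
  t := f.c * g.s + f.d * g.t + f.t
  det_eq := by
    have h : (f.a * g.a + f.b * g.c) * (f.c * g.b + f.d * g.d) -
        (f.a * g.b + f.b * g.d) * (f.c * g.a + f.d * g.c) =
        (f.a * f.d - f.b * f.c) * (g.a * g.d - g.b * g.c) := by ring
    rw [h]
    rcases f.det_eq with h1 | h1 <;> rcases g.det_eq with h2 | h2 <;> rw [h1, h2] <;> norm_num

theorem comp_app (f g : UnimodularMap) (p : ℤ × ℤ) : (f.comp g).app p = f.app (g.app p) := by
  ext <;> simp only [app, comp] <;> ring

theorem app_injective (f : UnimodularMap) : Function.Injective f.app := by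
  intro p q h
  have h1 : f.a * (p.1 - q.1) + f.b * (p.2 - q.2) = 0 := by
    have := congrArg Prod.fst h; simp only [app] at this; linarith
  have h2 : f.c * (p.1 - q.1) + f.d * (p.2 - q.2) = 0 := by
    have := congrArg Prod.snd h; simp only [app] at this; linarith
  have e1 : (f.a * f.d - f.b * f.c) * (p.1 - q.1) = 0 := by linear_combination f.d * h1 - f.b * h2
  have e2 : (f.a * f.d - f.b * f.c) * (p.2 - q.2) = 0 := by linear_combination f.a * h2 - f.c * h1
  have hne : f.a * f.d - f.b * f.c ≠ 0 := by rcases f.det_eq with h | h <;> rw [h] <;> norm_num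
  ext
  · linarith [(mul_eq_zero.mp e1).resolve_left hne]
  · linarith [(mul_eq_zero.mp e2).resolve_left hne]

theorem area_app (f : UnimodularMap) (p q r : ℤ × ℤ) :
    (area (f.app p) (f.app q) (f.app r)).natAbs = (area p q r).natAbs := by
  have : area (f.app p) (f.app q) (f.app r) = (f.a * f.d - f.b * f.c) * area p q r := by
    simp only [area, app]; ring
  rw [this]
  rcases f.det_eq with h | h <;> simp [h]

end UnimodularMap

/-- Unimodular equivalence of finite sets of lattice points. -/
def UEquiv (S T : Finset (ℤ × ℤ)) : Prop := ∃ f : UnimodularMap, S.image f.app = T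

theorem UEquiv.trans {S T U : Finset (ℤ × ℤ)} (h : UEquiv S T) (h' : UEquiv T U) : UEquiv S U := by
  obtain ⟨f, rfl⟩ := h
  obtain ⟨g, rfl⟩ := h'
  refine ⟨g.comp f, ?_⟩
  rw [Finset.image_image]
  exact Finset.image_congr fun p _ => g.comp_app f p

/-! ### Triangle-closed sets and removal of a vertex -/

/-- `S` contains all lattice points of all (possibly degenerate) triangles with vertices in `S`. -/
def TriangleClosed (S : Finset (ℤ × ℤ)) : Prop :=
  ∀ p ∈ S, ∀ q ∈ S, ∀ r ∈ S, ∀ l m n : ℤ, 0 ≤ l → 0 ≤ m → 0 ≤ n → 0 < l + m + n → ∀ w : ℤ × ℤ,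
    (l + m + n) * w.1 = l * p.1 + m * q.1 + n * r.1 →
    (l + m + n) * w.2 = l * p.2 + m * q.2 + n * r.2 → w ∈ S

theorem TriangleClosed.segment {S : Finset (ℤ × ℤ)} (hS : TriangleClosed S) {p q : ℤ × ℤ}
    (hp : p ∈ S) (hq : q ∈ S) {l m : ℤ} (hl : 0 ≤ l) (hm : 0 ≤ m) (h : 0 < l + m) {w : ℤ × ℤ}
    (h1 : (l + m) * w.1 = l * p.1 + m * q.1) (h2 : (l + m) * w.2 = l * p.2 + m * q.2) : w ∈ S :=
  hS p hp q hq q hq l m 0 hl hm le_rfl (by linarith) w (by linarith) (by linarith)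

theorem TriangleClosed.image {S : Finset (ℤ × ℤ)} (hS : TriangleClosed S) (f : UnimodularMap) :
    TriangleClosed (S.image f.app) := by
  intro p hp q hq r hr l m n hl hm hn hpos w h1 h2
  obtain ⟨p, hpS, rfl⟩ := Finset.mem_image.mp hp
  obtain ⟨q, hqS, rfl⟩ := Finset.mem_image.mp hq
  obtain ⟨r, hrS, rfl⟩ := Finset.mem_image.mp hr
  simp only [UnimodularMap.app] at h1 h2
  obtain ⟨e, he, hee⟩ : ∃ e : ℤ, e * (f.a * f.d - f.b * f.c) = 1 ∧ e * e = 1 := by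
    rcases f.det_eq with h | h
    · exact ⟨1, by rw [h]; norm_num, by norm_num⟩
    · exact ⟨-1, by rw [h]; norm_num, by norm_num⟩
  -- The preimage of `w`: as `e` is the inverse of the determinant, `e` times the adjugate inverts
  -- the linear part.
  refine Finset.mem_image.mpr ⟨(e * (f.d * (w.1 - f.s) - f.b * (w.2 - f.t)),
    e * (f.a * (w.2 - f.t) - f.c * (w.1 - f.s))), ?_, ?_⟩
  · refine hS p hpS q hqS r hrS l m n hl hm hn hpos _ ?_ ?_
    · linear_combination e * f.d * h1 - e * f.b * h2 + (l * p.1 + m * q.1 + n * r.1) * he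
    · linear_combination e * f.a * h2 - e * f.c * h1 + (l * p.2 + m * q.2 + n * r.2) * he
  · ext
    · simp only [UnimodularMap.app]; linear_combination (w.1 - f.s) * he
    · simp only [UnimodularMap.app]; linear_combination (w.2 - f.t) * he

/-- The lexicographically largest point of a closed set can be removed. -/
theorem TriangleClosed.exists_erase {S : Finset (ℤ × ℤ)} (hS : TriangleClosed S)
    (hne : S.Nonempty) : ∃ v ∈ S, TriangleClosed (S.erase v) := by
  obtain ⟨v, hv, hmax⟩ := Finset.exists_max_image S toLex hne
  refine ⟨v, hv, ?_⟩
  have key : ∀ p ∈ S.erase v, p.1 ≤ v.1 ∧ (p.1 = v.1 → p.2 < v.2) := by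
    intro p hp
    obtain ⟨hpv, hpS⟩ := Finset.mem_erase.mp hp
    have := hmax p hpS
    rw [Prod.Lex.toLex_le_toLex] at this
    rcases this with h | ⟨h, h'⟩
    · exact ⟨h.le, fun h' => absurd h' h.ne⟩
    · exact ⟨h.le, fun _ => lt_of_le_of_ne h' fun e => hpv (Prod.ext h e)⟩
  -- If `v` were a weighted mean of smaller points, the nonnegative terms `l * (v.1 - p.1)` would
  -- sum to zero and vanish. Then the same happens in the second coordinate, so all weights are
  -- zero, against `0 < l + m + n`.
  have weight : ∀ p ∈ S.erase v, ∀ l : ℤ, 0 ≤ l → 0 ≤ l * (v.1 - p.1) ∧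
      (l * (v.1 - p.1) = 0 → 0 ≤ l * (v.2 - p.2) ∧ (l * (v.2 - p.2) = 0 → l = 0)) := by
    intro p hp l hl
    obtain ⟨h1, h2⟩ := key p hp
    refine ⟨mul_nonneg hl (by linarith), fun h => ?_⟩
    rcases mul_eq_zero.mp h with h | h
    · simp [h]
    · have h3 := h2 (by linarith)
      exact ⟨mul_nonneg hl (by linarith), fun h4 => (mul_eq_zero.mp h4).resolve_right (by linarith)⟩
  intro p hp q hq r hr l m n hl hm hn hpos w h1 h2
  refine Finset.mem_erase.mpr ⟨?_, hS p (Finset.mem_of_mem_erase hp) q (Finset.mem_of_mem_erase hq)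
    r (Finset.mem_of_mem_erase hr) l m n hl hm hn hpos w h1 h2⟩
  rintro rfl
  obtain ⟨p1, p2⟩ := weight p hp l hl
  obtain ⟨q1, q2⟩ := weight q hq m hm
  obtain ⟨r1, r2⟩ := weight r hr n hn
  obtain ⟨p3, p4⟩ := p2 (by linarith)
  obtain ⟨q3, q4⟩ := q2 (by linarith)
  obtain ⟨r3, r4⟩ := r2 (by linarith)
  have := p4 (by linarith)
  have := q4 (by linarith)
  have := r4 (by linarith)
  linarith

/-! ### Bounds on the coordinates of a closed set -/

/-- A closed set containing a triangle with base `(0, 0), (1, 0)` and height `y` has, for every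
intermediate height `h`, a point at height `h` or at height `y - h`. -/
theorem TriangleClosed.exists_height {S : Finset (ℤ × ℤ)} (hS : TriangleClosed S)
    (h0 : (0, 0) ∈ S) (h1 : (1, 0) ∈ S) {x y : ℤ} (hv : (x, y) ∈ S) {h : ℤ} (hh : 0 < h)
    (hy : h < y) : ∃ p ∈ S, p.2 = h ∨ p.2 = y - h := by
  have hy0 : 0 < y := hh.trans hy
  -- `(c, h)` is the leftmost lattice point at height `h` that is not left of the line to `(x, y)`
  obtain ⟨c, hc1, hc2⟩ : ∃ c : ℤ, 0 ≤ c * y - h * x ∧ c * y - h * x < y := by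
    refine ⟨-((-(h * x)) / y), ?_, ?_⟩
    · nlinarith [Int.mul_ediv_self_le (x := -(h * x)) (k := y) hy0.ne']
    · nlinarith [Int.lt_mul_ediv_self_add (x := -(h * x)) (k := y) hy0]
  rcases le_or_gt (c * y - h * x + h) y with hle | hgt
  · refine ⟨(c, h), ?_, Or.inl rfl⟩
    exact hS _ h0 _ h1 _ hv (y - (c * y - h * x) - h) (c * y - h * x) h (by linarith) hc1 hh.le
      (by linarith) _ (by simp; ring) (by simp; ring)
  -- Now `(c, h)` lies beyond the side from (1, 0) to (x, y). The point reflection of the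
  -- parallelogram (0, 0), (1, 0), (1 + x, y), (x, y) takes it into the triangle. The weights are
  -- barycentric coordinates times `y`.
  · refine ⟨(1 + x - c, y - h), ?_, Or.inr rfl⟩
    exact hS _ h0 _ h1 _ hv (c * y - h * x + h - y) (y - (c * y - h * x)) (y - h) (by linarith)
      (by linarith) (by linarith) (by linarith) _ (by simp; ring) (by simp; ring)

/-- One of the heights h and y - h is always occupied, so at least half of the y - 1 intermediate
heights are. Three more points lie at the heights 0, 0 and y. -/
theorem TriangleClosed.height_le {S : Finset (ℤ × ℤ)} (hS : TriangleClosed S)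
    (h0 : (0, 0) ∈ S) (h1 : (1, 0) ∈ S) {x y : ℤ} (hv : (x, y) ∈ S) (hy : 0 < y) :
    y + 5 ≤ 2 * S.card := by
  set H := ((S.image Prod.snd).filter fun h => 0 < h ∧ h < y) with hH
  have hcover : Finset.Ioo 0 y ⊆ H ∪ H.image fun h => y - h := by
    intro h hh
    obtain ⟨hh1, hh2⟩ := Finset.mem_Ioo.mp hh
    obtain ⟨p, hp, hp'⟩ := hS.exists_height h0 h1 hv hh1 hh2
    rcases hp' with e | e
    · exact Finset.mem_union_left _ (Finset.mem_filter.mpr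
        ⟨Finset.mem_image.mpr ⟨p, hp, e⟩, hh1, hh2⟩)
    · refine Finset.mem_union_right _ (Finset.mem_image.mpr ⟨y - h, Finset.mem_filter.mpr
        ⟨Finset.mem_image.mpr ⟨p, hp, e⟩, by linarith, by linarith⟩, by ring⟩)
  have hcard : (Finset.Ioo 0 y).card ≤ 2 * H.card := by
    calc _ ≤ _ := Finset.card_le_card hcover
      _ ≤ H.card + (H.image fun h => y - h).card := Finset.card_union_le _ _
      _ ≤ H.card + H.card := Nat.add_le_add_left Finset.card_image_le _
      _ = _ := by ring
  have hsub : H.card + 3 ≤ S.card := by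
    have hH' : H ⊆ (S \ ({(0, 0), (1, 0), (x, y)} : Finset (ℤ × ℤ))).image Prod.snd := by
      intro h hh
      obtain ⟨hh1, hh2, hh3⟩ := Finset.mem_filter.mp hh
      obtain ⟨p, hp, rfl⟩ := Finset.mem_image.mp hh1
      refine Finset.mem_image.mpr ⟨p, Finset.mem_sdiff.mpr ⟨hp, ?_⟩, rfl⟩
      simp only [Finset.mem_insert, Finset.mem_singleton]
      rintro (rfl | rfl | rfl) <;> simp at hh2 hh3
    have h3 : ({(0, 0), (1, 0), (x, y)} : Finset (ℤ × ℤ)).card = 3 := by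
      rw [Finset.card_eq_three]
      refine ⟨_, _, _, by simp, ?_, ?_, rfl⟩ <;>
      · intro e
        have := congrArg Prod.snd e
        simp at this
        omega
    have hT : ({(0, 0), (1, 0), (x, y)} : Finset (ℤ × ℤ)) ⊆ S := by
      intro p hp
      simp only [Finset.mem_insert, Finset.mem_singleton] at hp
      rcases hp with rfl | rfl | rfl <;> assumption
    have := Finset.card_sdiff_add_card_eq_card hT
    have hle : H.card ≤ (S \ ({(0, 0), (1, 0), (x, y)} : Finset (ℤ × ℤ))).card :=
      (Finset.card_le_card hH').trans Finset.card_image_le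
    omega
  rw [Int.card_Ioo] at hcard
  omega

/-! ### Tables of representatives and the finite check -/

/-- The lattice points of the polygons `P7 i`. -/
def pts7 : Fin 22 → List (ℤ × ℤ) :=
  ![[(0, 0), (1, 0), (2, 0), (3, 0), (4, 0), (5, 0), (6, 0)],
    [(0, 0), (0, 1), (1, 0), (2, 0), (3, 0), (4, 0), (5, 0)],
    [(0, 0), (0, 1), (1, 0), (1, 1), (2, 0), (3, 0), (4, 0)],
    [(0, 0), (0, 1), (1, 0), (1, 1), (2, 0), (2, 1), (3, 0)],
    [(0, 0), (0, 1), (0, 2), (1, 0), (1, 1), (2, 0), (2, 1)],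
    [(0, 0), (0, 1), (1, 0), (1, 1), (1, 2), (2, 0), (2, 1)],
    [(-1, -1), (-1, 0), (0, -1), (0, 0), (0, 1), (1, 0), (1, 1)],
    [(0, 0), (1, 0), (1, 1), (1, 2), (2, 0), (2, 1), (3, 0)],
    [(-1, -1), (-1, 0), (-1, 1), (0, -1), (0, 0), (1, 0), (2, 0)],
    [(-1, 0), (-1, 1), (0, -1), (0, 0), (1, -1), (1, 0), (2, 0)],
    [(0, 0), (0, 1), (1, 0), (2, -1), (2, 0), (3, -1), (3, 0)],
    [(-1, 0), (0, -1), (0, 0), (1, -1), (1, 0), (1, 1), (2, -1)],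
    [(-1, 0), (0, 0), (0, 1), (1, -1), (1, 0), (1, 1), (2, -1)],
    [(-1, 0), (-1, 1), (0, 0), (1, 0), (2, 0), (3, -1), (3, 0)],
    [(-1, 0), (-1, 1), (0, 0), (1, 0), (2, -1), (2, 0), (3, 0)],
    [(-1, 0), (-1, 1), (0, 0), (1, -1), (1, 0), (2, 0), (3, 0)],
    [(-1, 0), (-1, 1), (0, -1), (0, 0), (1, 0), (2, 0), (3, 0)],
    [(-1, -1), (-1, 0), (-1, 1), (0, 0), (1, 0), (2, 0), (3, 0)],
    [(-1, 1), (0, -1), (0, 0), (0, 1), (1, 0), (2, 0), (3, 0)],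
    [(-1, -1), (0, 0), (0, 1), (0, 2), (1, 0), (1, 1), (2, 0)],
    [(-1, 2), (0, -1), (0, 0), (0, 1), (1, 0), (1, 1), (2, 0)],
    [(-2, -1), (-1, 0), (-1, 1), (0, 0), (1, 0), (2, 0), (3, 0)]]

/-- Representatives of the two-dimensional closed sets with `k` points, `3 ≤ k ≤ 7`, each paired
with the list of all points `w` that can be added to it. Together with `w` are listed points `a`,
`b` of the set such that the set lies in the angle `awb`, and the index of the representative with
`k + 1` points that is obtained. -/
def reps : ℕ → List (List (ℤ × ℤ) × List ((ℤ × ℤ) × (ℤ × ℤ) × (ℤ × ℤ) × ℕ))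
  | 3 => [
      ([(0, 0), (1, 0), (0, 1)],
      [((-1, -1), (1, 0), (0, 1), 1), ((-1, 0), (0, 0), (0, 1), 0),
       ((-1, 1), (0, 0), (0, 1), 2), ((-1, 2), (0, 0), (1, 0), 0), ((-1, 3), (0, 0), (1, 0), 1),
       ((0, -1), (1, 0), (0, 0), 0), ((0, 2), (0, 0), (1, 0), 0), ((1, -1), (1, 0), (0, 0), 2),
       ((1, 1), (0, 1), (1, 0), 2), ((2, -1), (1, 0), (0, 0), 0), ((2, 0), (0, 1), (0, 0), 0),
       ((3, -1), (0, 1), (0, 0), 1)])]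
  | 4 => [
      ([(0, 0), (1, 0), (0, 1), (2, 0)],
      [((-1, -1), (2, 0), (0, 1), 1), ((-1, 0), (0, 0), (0, 1), 0),
       ((-1, 1), (0, 0), (0, 1), 2), ((-1, 2), (0, 0), (2, 0), 3), ((0, -1), (2, 0), (0, 0), 3),
       ((1, -1), (2, 0), (0, 0), 4), ((1, 1), (0, 1), (2, 0), 2), ((2, -1), (2, 0), (0, 0), 5),
       ((3, -1), (2, 0), (0, 0), 4), ((3, 0), (0, 1), (0, 0), 0), ((4, -1), (0, 1), (0, 0), 3),
       ((5, -1), (0, 1), (0, 0), 1)]),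
      ([(0, 0), (1, 0), (0, 1), (-1, -1)],
      [((-2, -2), (1, 0), (0, 1), 1), ((-1, 0), (-1, -1), (0, 1), 4),
       ((0, -1), (1, 0), (-1, -1), 4), ((0, 2), (-1, -1), (1, 0), 1),
       ((1, 1), (0, 1), (1, 0), 4), ((2, 0), (0, 1), (-1, -1), 1)]),
      ([(0, 0), (1, 0), (0, 1), (-1, 1)],
      [((-3, 2), (0, 0), (0, 1), 4), ((-2, 1), (0, 0), (0, 1), 2), ((-2, 2), (0, 0), (0, 1), 2),
       ((-1, 0), (0, 0), (-1, 1), 2), ((-1, 2), (-1, 1), (1, 0), 2),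
       ((0, -1), (1, 0), (-1, 1), 4), ((0, 2), (-1, 1), (1, 0), 4), ((1, -1), (1, 0), (0, 0), 2),
       ((1, 1), (0, 1), (1, 0), 2), ((2, -1), (1, 0), (0, 0), 2), ((2, 0), (0, 1), (0, 0), 2),
       ((3, -1), (0, 1), (0, 0), 4)])]
  | 5 => [
      ([(0, 0), (1, 0), (0, 1), (2, 0), (3, 0)],
      [((-1, -1), (3, 0), (0, 1), 1), ((-1, 0), (0, 0), (0, 1), 0),
       ((-1, 1), (0, 0), (0, 1), 2), ((0, -1), (3, 0), (0, 0), 3), ((1, -1), (3, 0), (0, 0), 4),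
       ((1, 1), (0, 1), (3, 0), 2), ((2, -1), (3, 0), (0, 0), 5), ((3, -1), (3, 0), (0, 0), 6),
       ((4, -1), (3, 0), (0, 0), 5), ((4, 0), (0, 1), (0, 0), 0), ((5, -1), (3, 0), (0, 0), 4),
       ((6, -1), (0, 1), (0, 0), 3), ((7, -1), (0, 1), (0, 0), 1)]),
      ([(0, 0), (1, 0), (0, 1), (2, 0), (-1, -1)],
      [((-1, 0), (-1, -1), (0, 1), 4), ((0, -1), (2, 0), (-1, -1), 7),
       ((1, 1), (0, 1), (2, 0), 7), ((3, 0), (0, 1), (-1, -1), 1)]),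
      ([(0, 0), (1, 0), (0, 1), (2, 0), (-1, 1)],
      [((-3, 2), (0, 0), (0, 1), 8), ((-2, 1), (0, 0), (0, 1), 9),
       ((-2, 2), (0, 0), (0, 1), 10), ((-1, 0), (0, 0), (-1, 1), 2),
       ((-1, 2), (-1, 1), (2, 0), 8), ((0, -1), (2, 0), (-1, 1), 7),
       ((1, -1), (2, 0), (0, 0), 8), ((1, 1), (0, 1), (2, 0), 9), ((2, -1), (2, 0), (0, 0), 11),
       ((3, -1), (2, 0), (0, 0), 11), ((3, 0), (0, 1), (0, 0), 2), ((4, -1), (0, 1), (0, 0), 8),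
       ((5, -1), (0, 1), (0, 0), 7)]),
      ([(0, 0), (1, 0), (0, 1), (2, 0), (-1, 2)],
      [((-2, 3), (0, 0), (2, 0), 3), ((-1, 1), (0, 0), (-1, 2), 8),
       ((0, -1), (2, 0), (-1, 2), 12), ((1, -1), (2, 0), (0, 0), 7),
       ((1, 1), (-1, 2), (2, 0), 8), ((2, -1), (2, 0), (0, 0), 5), ((3, -1), (2, 0), (0, 0), 7),
       ((4, -1), (-1, 2), (0, 0), 12)]),
      ([(0, 0), (1, 0), (0, 1), (2, 0), (1, -1)],
      [((-1, 0), (1, -1), (0, 1), 6), ((-1, 1), (0, 0), (0, 1), 8),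
       ((-1, 2), (0, 0), (2, 0), 7), ((0, -1), (1, -1), (0, 0), 8), ((1, -2), (2, 0), (0, 0), 7),
       ((1, 1), (0, 1), (2, 0), 11), ((2, -1), (2, 0), (1, -1), 11),
       ((3, 0), (0, 1), (1, -1), 4)]),
      ([(0, 0), (1, 0), (0, 1), (2, 0), (2, -1)],
      [((-1, 0), (2, -1), (0, 1), 5), ((-1, 1), (0, 0), (0, 1), 11),
       ((-1, 2), (0, 0), (2, 0), 5), ((1, -1), (2, -1), (0, 0), 11),
       ((1, 1), (0, 1), (2, 0), 11), ((3, -2), (2, 0), (0, 0), 5),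
       ((3, -1), (2, 0), (2, -1), 11), ((3, 0), (0, 1), (2, -1), 5)])]
  | 6 => [
      ([(0, 0), (1, 0), (0, 1), (2, 0), (3, 0), (4, 0)],
      [((-1, -1), (4, 0), (0, 1), 21), ((-1, 0), (0, 0), (0, 1), 1),
       ((-1, 1), (0, 0), (0, 1), 2), ((0, -1), (4, 0), (0, 0), 17),
       ((1, -1), (4, 0), (0, 0), 16), ((1, 1), (0, 1), (4, 0), 2), ((2, -1), (4, 0), (0, 0), 15),
       ((3, -1), (4, 0), (0, 0), 14), ((4, -1), (4, 0), (0, 0), 13),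
       ((5, -1), (4, 0), (0, 0), 14), ((5, 0), (0, 1), (0, 0), 1), ((6, -1), (4, 0), (0, 0), 15),
       ((7, -1), (4, 0), (0, 0), 16), ((8, -1), (0, 1), (0, 0), 17),
       ((9, -1), (0, 1), (0, 0), 21)]),
      ([(0, 0), (1, 0), (0, 1), (2, 0), (3, 0), (-1, -1)],
      [((-1, 0), (-1, -1), (0, 1), 16), ((0, -1), (3, 0), (-1, -1), 18),
       ((1, 1), (0, 1), (3, 0), 18), ((4, 0), (0, 1), (-1, -1), 21)]),
      ([(0, 0), (1, 0), (0, 1), (2, 0), (3, 0), (-1, 1)],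
      [((-3, 2), (0, 0), (0, 1), 7), ((-2, 1), (0, 0), (0, 1), 3), ((-2, 2), (0, 0), (3, 0), 7),
       ((-1, 0), (0, 0), (-1, 1), 2), ((0, -1), (3, 0), (-1, 1), 18),
       ((1, -1), (3, 0), (0, 0), 8), ((1, 1), (0, 1), (3, 0), 3), ((2, -1), (3, 0), (0, 0), 9),
       ((3, -1), (3, 0), (0, 0), 10), ((4, -1), (3, 0), (0, 0), 10), ((4, 0), (0, 1), (0, 0), 2),
       ((5, -1), (3, 0), (0, 0), 9), ((6, -1), (0, 1), (0, 0), 8),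
       ((7, -1), (0, 1), (0, 0), 18)]),
      ([(0, 0), (1, 0), (0, 1), (2, 0), (3, 0), (0, -1)],
      [((-1, -1), (0, -1), (0, 1), 18), ((-1, 0), (0, -1), (0, 1), 15),
       ((-1, 1), (0, -1), (0, 1), 18), ((1, -1), (3, 0), (0, -1), 8),
       ((1, 1), (0, 1), (3, 0), 8), ((4, 0), (0, 1), (0, -1), 17)]),
      ([(0, 0), (1, 0), (0, 1), (2, 0), (3, 0), (1, -1)],
      [((-1, 0), (1, -1), (0, 1), 14), ((-1, 1), (0, 0), (0, 1), 8),
       ((0, -1), (1, -1), (0, 0), 8), ((1, 1), (0, 1), (3, 0), 9), ((2, -1), (3, 0), (1, -1), 9),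
       ((4, 0), (0, 1), (1, -1), 16)]),
      ([(0, 0), (1, 0), (0, 1), (2, 0), (3, 0), (2, -1)],
      [((-1, 0), (2, -1), (0, 1), 13), ((-1, 1), (0, 0), (0, 1), 9),
       ((1, -1), (2, -1), (0, 0), 9), ((1, 1), (0, 1), (3, 0), 10),
       ((3, -1), (3, 0), (2, -1), 10), ((4, 0), (0, 1), (2, -1), 15)]),
      ([(0, 0), (1, 0), (0, 1), (2, 0), (3, 0), (3, -1)],
      [((-1, 0), (3, -1), (0, 1), 14), ((-1, 1), (0, 0), (0, 1), 10),
       ((1, 1), (0, 1), (3, 0), 10), ((2, -1), (3, -1), (0, 0), 10),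
       ((4, -1), (3, 0), (3, -1), 10), ((4, 0), (0, 1), (3, -1), 14)]),
      ([(0, 0), (1, 0), (0, 1), (2, 0), (-1, -1), (0, -1)],
      [((-2, -2), (2, 0), (0, 1), 19), ((-1, -2), (2, 0), (-1, -1), 20),
       ((-1, 0), (-1, -1), (0, 1), 9), ((1, -1), (2, 0), (-1, -1), 11),
       ((1, 1), (0, 1), (2, 0), 12), ((3, 0), (0, 1), (0, -1), 18)]),
      ([(0, 0), (1, 0), (0, 1), (2, 0), (-1, 1), (-3, 2)],
      [((-5, 3), (0, 0), (0, 1), 8), ((-2, 1), (0, 0), (-3, 2), 5),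
       ((-2, 2), (-3, 2), (0, 1), 4), ((1, -1), (2, 0), (-3, 2), 20),
       ((1, 1), (-3, 2), (2, 0), 11), ((2, -1), (2, 0), (0, 0), 12),
       ((3, -1), (2, 0), (0, 0), 10), ((3, 0), (0, 1), (0, 0), 7), ((4, -1), (0, 1), (0, 0), 11),
       ((5, -1), (0, 1), (0, 0), 20)]),
      ([(0, 0), (1, 0), (0, 1), (2, 0), (-1, 1), (-2, 1)],
      [((-5, 2), (0, 0), (0, 1), 11), ((-4, 2), (0, 0), (0, 1), 4),
       ((-3, 1), (0, 0), (0, 1), 3), ((-3, 2), (-2, 1), (0, 1), 5),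
       ((-2, 2), (-2, 1), (0, 1), 4), ((-1, 0), (0, 0), (-2, 1), 3),
       ((-1, 2), (-2, 1), (2, 0), 11), ((1, -1), (2, 0), (-2, 1), 11),
       ((1, 1), (0, 1), (2, 0), 3), ((2, -1), (2, 0), (0, 0), 4), ((3, -1), (2, 0), (0, 0), 5),
       ((3, 0), (0, 1), (0, 0), 3), ((4, -1), (0, 1), (0, 0), 4),
       ((5, -1), (0, 1), (0, 0), 11)]),
      ([(0, 0), (1, 0), (0, 1), (2, 0), (-1, 1), (-2, 2)],
      [((-5, 4), (0, 0), (2, 0), 19), ((-4, 3), (0, 0), (0, 1), 7),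
       ((-3, 2), (0, 0), (-2, 2), 4), ((-3, 3), (0, 0), (2, 0), 7),
       ((-2, 1), (0, 0), (-2, 2), 4), ((-1, 0), (0, 0), (-2, 2), 7),
       ((-1, 2), (-2, 2), (2, 0), 4), ((0, -1), (2, 0), (-2, 2), 19),
       ((1, -1), (2, 0), (0, 0), 7), ((1, 1), (-2, 2), (2, 0), 4), ((2, -1), (2, 0), (0, 0), 4),
       ((3, -1), (2, 0), (0, 0), 4), ((3, 0), (-2, 2), (0, 0), 7), ((4, -1), (0, 1), (0, 0), 7),
       ((5, -1), (-2, 2), (0, 0), 19)]),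
      ([(0, 0), (1, 0), (0, 1), (2, 0), (-1, 1), (2, -1)],
      [((-3, 2), (0, 0), (0, 1), 12), ((-2, 1), (0, 0), (0, 1), 4),
       ((-2, 2), (0, 0), (0, 1), 4), ((-1, 0), (2, -1), (-1, 1), 10),
       ((-1, 2), (-1, 1), (2, 0), 10), ((1, -1), (2, -1), (0, 0), 5),
       ((1, 1), (0, 1), (2, 0), 5), ((3, -2), (2, 0), (0, 0), 9), ((3, -1), (2, 0), (2, -1), 6),
       ((3, 0), (0, 1), (2, -1), 9)]),
      ([(0, 0), (1, 0), (0, 1), (2, 0), (-1, 2), (0, -1)],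
      [((-1, 1), (0, -1), (-1, 2), 20), ((1, -1), (2, 0), (0, -1), 20),
       ((1, 1), (-1, 2), (2, 0), 20)])]
  | 7 => (List.finRange 22).map fun i => (pts7 i, [])
  | _ => []

/-- Searches for an affine unimodular map that sends the points of `S` into `T`; such a map is
determined by the images `A`, `B`, `C` of `(0, 0)`, `(1, 0)`, `(0, 1)`. -/
def findMap (S T : List (ℤ × ℤ)) : Bool :=
  T.any fun A => T.any fun B => T.any fun C =>
    (area A B C).natAbs == 1 && S.all fun p =>
      T.contains (A.1 + p.1 * (B.1 - A.1) + p.2 * (C.1 - A.1),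
        A.2 + p.1 * (B.2 - A.2) + p.2 * (C.2 - A.2))

/-- The point `v` is in `S`, or it is listed in `E` and `S ∪ {v}` is equivalent to the set in `R`
with the index given there, or the closure of `S ∪ {v}` contains another point listed in `E`. -/
def checkPoint (S : List (ℤ × ℤ)) (E : List ((ℤ × ℤ) × (ℤ × ℤ) × (ℤ × ℤ) × ℕ))
    (R : List (List (ℤ × ℤ))) (v : ℤ × ℤ) : Bool :=
  S.contains v || E.any fun w =>
    if w.1 = v then R[w.2.2.2]?.any (findMap (v :: S))
    else decide (0 ≤ area w.1 w.2.2.1 v) && decide (0 ≤ area w.2.1 w.1 v)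

/-- The integers from `-B` to `B`. -/
def intRange (B : ℕ) : List ℤ := (List.range (2 * B + 1)).map fun i : ℕ => (i : ℤ) - B

/-- The points listed in `E` are new, and the triangles listed with them are as they should be. -/
def checkCones (S : List (ℤ × ℤ)) (E : List ((ℤ × ℤ) × (ℤ × ℤ) × (ℤ × ℤ) × ℕ)) : Bool :=
  E.all fun w => !S.contains w.1 && S.contains w.2.1 && S.contains w.2.2.1 &&
    decide (0 < area w.2.1 w.2.2.1 w.1)

/-- `checkPoint` holds for all possible new points of all representatives with `k` points. -/
def checkLevel (k : ℕ) : Bool :=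
  (reps k).all fun S => checkCones S.1 S.2 &&
    (intRange (2 * k - 3)).all fun x => (intRange (2 * k - 3)).all fun y =>
      checkPoint S.1 S.2 ((reps (k + 1)).map Prod.fst) (x, y)

theorem checkLevel_three : checkLevel 3 = true := by decide +kernel
theorem checkLevel_four : checkLevel 4 = true := by decide +kernel
theorem checkLevel_five : checkLevel 5 = true := by decide +kernel
theorem checkLevel_six : checkLevel 6 = true := by decide +kernel

/-- `findMap` tests only an inclusion; injectivity and equal cardinalities turn it into an equality.
-/
theorem UEquiv.of_findMap {S T : List (ℤ × ℤ)} (h : findMap S T = true)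
    (hcard : S.toFinset.card = T.toFinset.card) : UEquiv S.toFinset T.toFinset := by
  simp only [findMap, List.any_eq_true, Bool.and_eq_true, beq_iff_eq, List.all_eq_true,
    List.contains_iff_mem] at h
  obtain ⟨A, -, B, -, C, -, hdet, hmem⟩ := h
  let f : UnimodularMap :=
    { a := B.1 - A.1, b := C.1 - A.1, c := B.2 - A.2, d := C.2 - A.2, s := A.1, t := A.2
      det_eq := by
        have h1 := Int.natAbs_eq (area A B C)
        rw [hdet] at h1
        simp only [area] at h1
        rcases h1 with h1 | h1
        · left; push_cast at h1; linarith
        · right; push_cast at h1; linarith }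
  refine ⟨f, Finset.eq_of_subset_of_card_le ?_ ?_⟩
  · intro q hq
    obtain ⟨p, hp, rfl⟩ := Finset.mem_image.mp hq
    have := hmem p (List.mem_toFinset.mp hp)
    rw [List.mem_toFinset]
    convert this using 1
    ext <;> simp only [f, UnimodularMap.app] <;> ring
  · rw [Finset.card_image_of_injective _ f.app_injective, hcard]

theorem mem_intRange {B : ℕ} {x : ℤ} (h : x.natAbs ≤ B) : x ∈ intRange B := by
  exact List.mem_map.mpr ⟨(x + B).toNat, List.mem_range.mpr (by omega), by omega⟩

/-! ### Adding a point to a representative -/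

/-- Closed sets contain every lattice point of a triangle with vertices in them. -/
theorem TriangleClosed.mem_of_area {S : Finset (ℤ × ℤ)} (hS : TriangleClosed S)
    {a b c w : ℤ × ℤ} (ha : a ∈ S) (hb : b ∈ S) (hc : c ∈ S) (h1 : 0 ≤ area w b c)
    (h2 : 0 ≤ area a w c) (h3 : 0 < area a b w) : w ∈ S := by
  -- These weights are the barycentric coordinates of `w`, scaled by their sum `area a b c`.
  refine hS a ha b hb c hc (area w b c) (area a w c) (area a b w) h1 h2 h3.le (by linarith) w ?_ ?_
  · simp only [area]; ring
  · simp only [area]; ring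

/-- Reflection in the horizontal axis, followed by a shear along it. -/
def reflectShear (m : ℤ) : UnimodularMap := ⟨1, m, 0, -1, 0, 0, by norm_num⟩

/-- A shear along the horizontal axis. -/
def shear (m : ℤ) : UnimodularMap := ⟨1, m, 0, 1, 0, 0, by norm_num⟩

/-- The exchange of the coordinates. -/
def swap : UnimodularMap := ⟨0, 1, 1, 0, 0, 0, by norm_num⟩

theorem TriangleClosed.natAbs_snd_le {S : Finset (ℤ × ℤ)} (hS : TriangleClosed S)
    (h0 : (0, 0) ∈ S) (h1 : (1, 0) ∈ S) {v : ℤ × ℤ} (hv : v ∈ S) :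
    v.2 = 0 ∨ v.2.natAbs + 5 ≤ 2 * S.card := by
  rcases lt_trichotomy v.2 0 with h | h | h
  · have hS' := hS.image (reflectShear 0)
    have mem : ∀ p ∈ S, (p.1, -p.2) ∈ S.image (reflectShear 0).app := fun p hp =>
      Finset.mem_image.mpr ⟨p, hp, by simp [reflectShear, UnimodularMap.app]⟩
    have := hS'.height_le (by simpa using mem _ h0) (by simpa using mem _ h1) (mem _ hv)
      (by linarith)
    rw [Finset.card_image_of_injective _ (reflectShear 0).app_injective] at this
    omega
  · exact Or.inl h
  · have := hS.height_le h0 h1 (x := v.1) (y := v.2) hv h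
    omega

theorem TriangleClosed.natAbs_fst_le {S : Finset (ℤ × ℤ)} (hS : TriangleClosed S)
    (h0 : (0, 0) ∈ S) (h1 : (0, 1) ∈ S) {v : ℤ × ℤ} (hv : v ∈ S) :
    v.1 = 0 ∨ v.1.natAbs + 5 ≤ 2 * S.card := by
  have mem : ∀ p ∈ S, (p.2, p.1) ∈ S.image swap.app := fun p hp =>
    Finset.mem_image.mpr ⟨p, hp, by simp [swap, UnimodularMap.app]⟩
  have := (hS.image swap).natAbs_snd_le (mem _ h0) (mem _ h1) (mem _ hv)
  rwa [Finset.card_image_of_injective _ swap.app_injective] at this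

/-- If `v` lies in the cone at a listed `w ≠ v` opposite to its triangle, then `w` is in the
triangle `a b v`. Closedness would make `w` a further new point, which is impossible. So `v` itself
is listed, with an equivalence that `findMap` has verified. -/
theorem exists_rep_of_insert {k : ℕ} (hk : 3 ≤ k) (hcheck : checkLevel k = true)
    (hcard : ∀ T ∈ reps (k + 1), T.1.toFinset.card = k + 1)
    {S : List (ℤ × ℤ) × List ((ℤ × ℤ) × (ℤ × ℤ) × (ℤ × ℤ) × ℕ)} (hS : S ∈ reps k)
    (hbase : (0, 0) ∈ S.1 ∧ (1, 0) ∈ S.1 ∧ (0, 1) ∈ S.1) {v : ℤ × ℤ}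
    (hclosed : TriangleClosed (insert v S.1.toFinset))
    (hcardS : (insert v S.1.toFinset).card = k + 1) (hv : v ∉ S.1) :
    ∃ T ∈ reps (k + 1), UEquiv (insert v S.1.toFinset) T.1.toFinset := by
  obtain ⟨h0, h1, h2⟩ := hbase
  have mem : ∀ {p}, p ∈ S.1 → p ∈ insert v S.1.toFinset := fun h =>
    Finset.mem_insert_of_mem (List.mem_toFinset.mpr h)
  have hvm : v ∈ insert v S.1.toFinset := Finset.mem_insert_self _ _
  -- The enlarged set has `k + 1` points, and 2(k + 1) - 5 = 2k - 3.
  have hx : v.1 ∈ intRange (2 * k - 3) := by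
    have := hclosed.natAbs_fst_le (mem h0) (mem h2) hvm
    exact mem_intRange (by omega)
  have hy : v.2 ∈ intRange (2 * k - 3) := by
    have := hclosed.natAbs_snd_le (mem h0) (mem h1) hvm
    exact mem_intRange (by omega)
  simp only [checkLevel, List.all_eq_true, Bool.and_eq_true] at hcheck
  obtain ⟨hcones, hpt⟩ := hcheck S hS
  have hpt := hpt _ hx _ hy
  simp only [checkPoint, Bool.or_eq_true, List.contains_iff_mem, List.any_eq_true] at hpt
  rcases hpt with hpt | ⟨w, hw, hpt⟩
  · exact absurd hpt hv
  split_ifs at hpt with hwv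
  · simp only [Option.any_eq_true] at hpt
    obtain ⟨T, hT, hmap⟩ := hpt
    obtain ⟨T', hT', rfl⟩ := List.mem_map.mp (List.mem_of_getElem? hT)
    refine ⟨T', hT', ?_⟩
    have := UEquiv.of_findMap hmap (by rw [hcard _ hT', List.toFinset_cons]; exact hcardS)
    rwa [List.toFinset_cons] at this
  · exfalso
    simp only [checkCones, List.all_eq_true, Bool.and_eq_true, Bool.not_eq_true',
      decide_eq_true_eq, List.contains_iff_mem] at hcones hpt
    obtain ⟨⟨⟨hwS, ha⟩, hb⟩, hpos⟩ := hcones w hw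
    have hwS : w.1 ∉ S.1 := by simpa using hwS
    have := hclosed.mem_of_area (mem ha) (mem hb) hvm hpt.1 hpt.2 hpos
    rcases Finset.mem_insert.mp this with h | h
    · exact hwv h
    · exact hwS (List.mem_toFinset.mp h)

/-! ### Adding a point to a segment -/

/-- The lattice points of a horizontal segment. -/
def latticeSegment (k : ℕ) : Finset (ℤ × ℤ) := (Finset.range k).image fun i : ℕ => ((i : ℤ), 0)

theorem mem_latticeSegment {k : ℕ} {p : ℤ × ℤ} : p ∈ latticeSegment k ↔ 0 ≤ p.1 ∧ p.1 < k ∧ p.2 = 0 := by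
  simp only [latticeSegment, Finset.mem_image, Finset.mem_range]
  constructor
  · rintro ⟨i, hi, rfl⟩
    exact ⟨by positivity, by simpa using hi, rfl⟩
  · rintro ⟨h1, h2, h3⟩
    exact ⟨p.1.toNat, by omega, Prod.ext (by simp [h1]) h3.symm⟩

theorem card_latticeSegment (k : ℕ) : (latticeSegment k).card = k := by
  rw [latticeSegment, Finset.card_image_of_injective, Finset.card_range]
  intro i j h
  simpa using h

theorem UEquiv.of_subset {S T : Finset (ℤ × ℤ)} (f : UnimodularMap) (h : ∀ p ∈ S, f.app p ∈ T)
    (hcard : T.card ≤ S.card) : UEquiv S T :=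
  ⟨f, Finset.eq_of_subset_of_card_le (Finset.image_subset_iff.mpr h)
    (by rwa [Finset.card_image_of_injective _ f.app_injective])⟩

/-- On the line of the segment, closedness leaves no gap before the new point. Off the line its
height is ±1, since otherwise `TriangleClosed.exists_height` gives a point strictly between; a
shear, after a reflection if needed, then moves it to (0, 1). -/
theorem uequiv_of_insert_latticeSegment {k : ℕ} (hk : 2 ≤ k) {v : ℤ × ℤ}
    (hclosed : TriangleClosed (insert v (latticeSegment k))) (hv : v ∉ latticeSegment k) :
    UEquiv (insert v (latticeSegment k)) (latticeSegment (k + 1)) ∨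
      UEquiv (insert v (latticeSegment k)) (insert (0, 1) (latticeSegment k)) := by
  have mem : ∀ {p}, p ∈ latticeSegment k → p ∈ insert v (latticeSegment k) := fun h =>
    Finset.mem_insert_of_mem h
  have h0 : (0, 0) ∈ latticeSegment k := mem_latticeSegment.mpr (by simp; omega)
  have h1 : (1, 0) ∈ latticeSegment k := mem_latticeSegment.mpr (by simp; omega)
  have hlast : ((k : ℤ) - 1, 0) ∈ latticeSegment k := mem_latticeSegment.mpr (by simp; omega)
  have hvm : v ∈ insert v (latticeSegment k) := Finset.mem_insert_self _ _
  have hcard : (insert v (latticeSegment k)).card = k + 1 := by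
    rw [Finset.card_insert_of_notMem hv, card_latticeSegment]
  have hcard' : (insert (0, 1) (latticeSegment k)).card = k + 1 := by
    rw [Finset.card_insert_of_notMem (by simp [mem_latticeSegment]), card_latticeSegment]
  obtain ⟨x, y⟩ := v
  rcases eq_or_ne y 0 with rfl | hy
  · left
    have hx : x < 0 ∨ k ≤ x := by
      by_contra! h
      exact hv (mem_latticeSegment.mpr ⟨h.1, h.2, rfl⟩)
    rcases hx with hx | hx
    · have hm : (-1, 0) ∈ insert (x, 0) (latticeSegment k) :=
        hclosed.segment hvm (mem h0) (l := 1) (m := -x - 1) (by norm_num) (by linarith)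
          (by linarith) (by simp) (by simp)
      have hx1 : x = -1 := by
        rcases Finset.mem_insert.mp hm with h | h
        · exact (congrArg Prod.fst h).symm
        · have := (mem_latticeSegment.mp h).1; simp at this
      refine UEquiv.of_subset ⟨1, 0, 0, 1, 1, 0, by norm_num⟩ (fun p hp => ?_)
        (by rw [hcard, card_latticeSegment])
      simp only [Finset.mem_insert, mem_latticeSegment] at hp
      rcases hp with rfl | ⟨p1, p2, p3⟩
      · simp [UnimodularMap.app, mem_latticeSegment, hx1]
      · simp [UnimodularMap.app, mem_latticeSegment, p3]; omega
    · have hm : ((k : ℤ), 0) ∈ insert (x, 0) (latticeSegment k) :=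
        hclosed.segment hvm (mem hlast) (l := 1) (m := x - k) (by norm_num) (by linarith)
          (by linarith) (by simp; ring) (by simp)
      have hx1 : x = k := by
        rcases Finset.mem_insert.mp hm with h | h
        · exact (congrArg Prod.fst h).symm
        · have := (mem_latticeSegment.mp h).2.1; simp at this
      refine UEquiv.of_subset ⟨1, 0, 0, 1, 0, 0, by norm_num⟩ (fun p hp => ?_)
        (by rw [hcard, card_latticeSegment])
      simp only [Finset.mem_insert, mem_latticeSegment] at hp
      rcases hp with rfl | ⟨p1, p2, p3⟩
      · simp [UnimodularMap.app, mem_latticeSegment, hx1]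
      · simp [UnimodularMap.app, mem_latticeSegment, p3]; omega
  · right
    rcases lt_or_gt_of_ne hy with hneg | hpos
    · have hy1 : y = -1 := by
        by_contra hne
        have hS' := hclosed.image (reflectShear 0)
        have mem' : ∀ p ∈ insert (x, y) (latticeSegment k),
            (p.1, -p.2) ∈ (insert (x, y) (latticeSegment k)).image (reflectShear 0).app := fun p hp =>
          Finset.mem_image.mpr ⟨p, hp, by simp [reflectShear, UnimodularMap.app]⟩
        obtain ⟨q, hq, hq'⟩ := hS'.exists_height (by simpa using mem' _ (mem h0))
          (by simpa using mem' _ (mem h1)) (mem' _ hvm) (h := 1) (by norm_num)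
          (by simp only; omega)
        obtain ⟨p, hp, rfl⟩ := Finset.mem_image.mp hq
        simp only [Finset.mem_insert, mem_latticeSegment] at hp
        simp only [reflectShear, UnimodularMap.app] at hq'
        rcases hp with rfl | ⟨-, -, p3⟩ <;> omega
      refine UEquiv.of_subset (reflectShear x) (fun p hp => ?_) (by rw [hcard, hcard'])
      simp only [Finset.mem_insert, mem_latticeSegment] at hp ⊢
      rcases hp with rfl | ⟨p1, p2, p3⟩
      · left; simp [reflectShear, UnimodularMap.app, hy1]
      · right; simp [reflectShear, UnimodularMap.app, p1, p2, p3]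
    · have hy1 : y = 1 := by
        by_contra hne
        obtain ⟨p, hp, hp'⟩ := hclosed.exists_height (mem h0) (mem h1) hvm (h := 1) (by norm_num)
          (by omega)
        simp only [Finset.mem_insert, mem_latticeSegment] at hp
        rcases hp with rfl | ⟨-, -, p3⟩ <;> omega
      refine UEquiv.of_subset (shear (-x)) (fun p hp => ?_) (by rw [hcard, hcard'])
      simp only [Finset.mem_insert, mem_latticeSegment] at hp ⊢
      rcases hp with rfl | ⟨p1, p2, p3⟩
      · left; simp [shear, UnimodularMap.app, hy1]
      · right; simp [shear, UnimodularMap.app, p1, p2, p3]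

/-! ### Induction on the number of points -/

/-- A finite set that is equivalent to a segment or to one of the representatives. -/
def Classified (k : ℕ) (S : Finset (ℤ × ℤ)) : Prop :=
  UEquiv S (latticeSegment k) ∨ ∃ T ∈ reps k, UEquiv S T.1.toFinset

theorem UEquiv.insert_erase {S T : Finset (ℤ × ℤ)} {v : ℤ × ℤ} (hv : v ∈ S)
    (hS : TriangleClosed S) (h : UEquiv (S.erase v) T) :
    ∃ w, w ∉ T ∧ TriangleClosed (insert w T) ∧ UEquiv S (insert w T) := by
  obtain ⟨f, rfl⟩ := h
  have hins : S.image f.app = insert (f.app v) ((S.erase v).image f.app) := by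
    rw [← Finset.image_insert, Finset.insert_erase hv]
  refine ⟨f.app v, ?_, hins ▸ hS.image f, f, hins⟩
  intro hmem
  obtain ⟨p, hp, hpv⟩ := Finset.mem_image.mp hmem
  exact Finset.ne_of_mem_erase hp (f.app_injective hpv)

theorem UEquiv.card_eq {S T : Finset (ℤ × ℤ)} (h : UEquiv S T) : S.card = T.card := by
  obtain ⟨f, rfl⟩ := h
  rw [Finset.card_image_of_injective _ f.app_injective]

/-- The deleted point is put back into the normal form of the rest. `reps 2` is empty, so for `k =
2` only the segment case occurs; the clause `k ≠ 2` in `hbase` yields `3 ≤ k` in the other case. -/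
theorem classified_succ {k : ℕ} (hk : 2 ≤ k) (hcheck : 3 ≤ k → checkLevel k = true)
    (hbase : ∀ T ∈ reps k, k ≠ 2 ∧ (0, 0) ∈ T.1 ∧ (1, 0) ∈ T.1 ∧ (0, 1) ∈ T.1)
    (hcard : ∀ T ∈ reps (k + 1), T.1.toFinset.card = k + 1)
    (hseg : ∃ T ∈ reps (k + 1), insert (0, 1) (latticeSegment k) ⊆ T.1.toFinset)
    (ih : ∀ S, TriangleClosed S → S.card = k → Classified k S)
    {S : Finset (ℤ × ℤ)} (hS : TriangleClosed S) (hSk : S.card = k + 1) :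
    Classified (k + 1) S := by
  obtain ⟨v, hv, hclosed⟩ := hS.exists_erase (Finset.card_pos.mp (by omega))
  rcases ih _ hclosed (by rw [Finset.card_erase_of_mem hv, hSk]; rfl) with h | ⟨T, hT, h⟩
  · obtain ⟨w, hw, hw', hSw⟩ := h.insert_erase hv hS
    rcases uequiv_of_insert_latticeSegment hk hw' hw with h' | h'
    · exact Or.inl (hSw.trans h')
    · obtain ⟨T, hT, hsub⟩ := hseg
      have hT' : insert (0, 1) (latticeSegment k) = T.1.toFinset :=
        Finset.eq_of_subset_of_card_le hsub (by rw [hcard T hT, ← h'.card_eq, ← hSw.card_eq, hSk])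
      exact Or.inr ⟨T, hT, hT' ▸ hSw.trans h'⟩
  · obtain ⟨w, hw, hw', hSw⟩ := h.insert_erase hv hS
    obtain ⟨hk2, hb⟩ := hbase T hT
    have hk3 : 3 ≤ k := by omega
    obtain ⟨U, hU, hU'⟩ := exists_rep_of_insert hk3 (hcheck hk3) hcard hT hb hw'
      (by rw [← hSw.card_eq, hSk]) (fun h => hw (List.mem_toFinset.mpr h))
    exact Or.inr ⟨U, hU, hSw.trans hU'⟩

theorem classified_two {S : Finset (ℤ × ℤ)} (hS : TriangleClosed S) (hS2 : S.card = 2) :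
    Classified 2 S := by
  obtain ⟨u, v, huv, rfl⟩ := Finset.card_eq_two.mp hS2
  set g : ℤ := ((Int.gcd (v.1 - u.1) (v.2 - u.2) : ℕ) : ℤ) with hg
  obtain ⟨x, hx⟩ : g ∣ v.1 - u.1 := Int.gcd_dvd_left ..
  obtain ⟨y, hy⟩ : g ∣ v.2 - u.2 := Int.gcd_dvd_right ..
  have hg0 : 0 < g := by
    rcases (Int.natCast_nonneg (Int.gcd (v.1 - u.1) (v.2 - u.2))).lt_or_eq with h | h
    · exact h
    · exfalso
      rw [← hg] at h
      rw [← h] at hx hy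
      exact huv (Prod.ext (by linarith) (by linarith))
  -- The lattice point u + (v - u)/g lies on the segment, so it is `u` or `v`; only `v` with `g = 1`
  -- is possible.
  have hg1 : g = 1 := by
    have hm := hS.segment (p := u) (q := v) (by simp) (by simp) (l := g - 1) (m := 1) (by omega)
      (by omega) (by omega) (w := (u.1 + x, u.2 + y)) (by simp; linarith) (by simp; linarith)
    simp only [Finset.mem_insert, Finset.mem_singleton] at hm
    rcases hm with h | h
    · exfalso
      have e1 : x = 0 := by simpa using congrArg Prod.fst h
      have e2 : y = 0 := by simpa using congrArg Prod.snd h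
      rw [e1] at hx
      rw [e2] at hy
      exact huv (Prod.ext (by linarith) (by linarith))
    · have e1 : u.1 + x = v.1 := congrArg Prod.fst h
      have e2 : u.2 + y = v.2 := congrArg Prod.snd h
      have f1 : (g - 1) * x = 0 := by linear_combination -e1 - hx
      have f2 : (g - 1) * y = 0 := by linear_combination -e2 - hy
      by_contra hne
      have hne' : g - 1 ≠ 0 := fun h => hne (by linarith)
      have z1 := (mul_eq_zero.mp f1).resolve_left hne'
      have z2 := (mul_eq_zero.mp f2).resolve_left hne'
      exact huv (Prod.ext (by linarith) (by linarith))
  have hbez := Int.gcd_eq_gcd_ab (v.1 - u.1) (v.2 - u.2)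
  rw [← hg, hg1] at hbez
  set m := Int.gcdA (v.1 - u.1) (v.2 - u.2)
  set n := Int.gcdB (v.1 - u.1) (v.2 - u.2)
  -- Bézout coefficients as first row give determinant 1; the map sends `u` to (0, 0) and `v` to (1,
  -- 0).
  refine Or.inl (UEquiv.of_subset ⟨m, n, -(v.2 - u.2), v.1 - u.1, -(m * u.1 + n * u.2),
    (v.2 - u.2) * u.1 - (v.1 - u.1) * u.2, Or.inl (by linarith)⟩ (fun p hp => ?_) (by
      rw [card_latticeSegment, hS2]))
  simp only [Finset.mem_insert, Finset.mem_singleton] at hp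
  rw [mem_latticeSegment]
  simp only [UnimodularMap.app]
  rcases hp with rfl | rfl
  · exact ⟨le_of_eq (by ring), lt_of_eq_of_lt (b := 0) (by ring) (by norm_num), by ring⟩
  · exact ⟨zero_le_one.trans_eq (by linear_combination hbez),
      lt_of_eq_of_lt (b := 1) (by linear_combination -hbez) (by norm_num), by ring⟩

theorem exists_uequiv_pts7 {S : Finset (ℤ × ℤ)} (hS : TriangleClosed S) (hS7 : S.card = 7) :
    ∃ i, UEquiv S (pts7 i).toFinset := by
  have c3 : ∀ S, TriangleClosed S → S.card = 3 → Classified 3 S := fun S hS h =>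
    classified_succ le_rfl (by omega) (by simp [reps]) (by decide +kernel) (by decide +kernel)
      (fun _ => classified_two) hS h
  have c4 : ∀ S, TriangleClosed S → S.card = 4 → Classified 4 S := fun S hS h =>
    classified_succ (by norm_num) (fun _ => checkLevel_three) (by decide +kernel)
      (by decide +kernel) (by decide +kernel) c3 hS h
  have c5 : ∀ S, TriangleClosed S → S.card = 5 → Classified 5 S := fun S hS h =>
    classified_succ (by norm_num) (fun _ => checkLevel_four) (by decide +kernel)
      (by decide +kernel) (by decide +kernel) c4 hS h
  have c6 : ∀ S, TriangleClosed S → S.card = 6 → Classified 6 S := fun S hS h =>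
    classified_succ (by norm_num) (fun _ => checkLevel_five) (by decide +kernel)
      (by decide +kernel) (by decide +kernel) c5 hS h
  have c7 : Classified 7 S := classified_succ (by norm_num) (fun _ => checkLevel_six)
      (by decide +kernel) (by decide +kernel) (by decide +kernel) c6 hS hS7
  rcases c7 with h | ⟨T, hT, h⟩
  · refine ⟨0, ?_⟩
    have : latticeSegment 7 = (pts7 0).toFinset :=
      Finset.eq_of_subset_of_card_le (by decide +kernel) (by decide +kernel)
    rwa [← this]
  · obtain ⟨i, -, rfl⟩ := List.mem_map.mp hT
    exact ⟨i, h⟩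

/-! ### Lattice points of the 22 polygons -/

/-- The linear inequalities that hold on the vertices of a lattice polygon hold on the polygon. -/
theorem le_of_mem_convexHull {V : Set (Fin 2 → ℤ)} {α β m : ℤ}
    (hV : ∀ c ∈ V, α * c 0 + β * c 1 ≤ m) {z : Fin 2 → ℤ}
    (hz : toPlane z ∈ convexHull ℝ (toPlane '' V)) : α * z 0 + β * z 1 ≤ m := by
  have hconv : Convex ℝ {x : Fin 2 → ℝ | (α : ℝ) * x 0 + β * x 1 ≤ m} := by
    intro x hx y hy a b ha hb hab
    simp only [Set.mem_ofPred_eq, Pi.add_apply, Pi.smul_apply, smul_eq_mul] at hx hy ⊢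
    have h1 := mul_le_mul_of_nonneg_left hx ha
    have h2 := mul_le_mul_of_nonneg_left hy hb
    have h3 : a * (m : ℝ) + b * m = m := by rw [← add_mul, hab, one_mul]
    linarith
  have hsub : toPlane '' V ⊆ {x : Fin 2 → ℝ | (α : ℝ) * x 0 + β * x 1 ≤ m} := by
    rintro _ ⟨c, hc, rfl⟩
    have := hV c hc
    simp only [Set.mem_ofPred_eq, toPlane]
    exact_mod_cast this
  have := convexHull_min hsub hconv hz
  simp only [Set.mem_ofPred_eq, toPlane] at this
  exact_mod_cast this

theorem toPlane_mem_of_weights {P : Set (Fin 2 → ℝ)} (hP : Convex ℝ P) {p q r w : Fin 2 → ℤ}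
    (hp : toPlane p ∈ P) (hq : toPlane q ∈ P) (hr : toPlane r ∈ P) {l m n : ℤ} (hl : 0 ≤ l)
    (hm : 0 ≤ m) (hn : 0 ≤ n) (hpos : 0 < l + m + n)
    (h : ∀ j, (l + m + n) * w j = l * p j + m * q j + n * r j) : toPlane w ∈ P := by
  have hs : (0 : ℝ) < l + m + n := by exact_mod_cast hpos
  have hl' : (0 : ℝ) ≤ l := by exact_mod_cast hl
  have hm' : (0 : ℝ) ≤ m := by exact_mod_cast hm
  have hn' : (0 : ℝ) ≤ n := by exact_mod_cast hn
  have key := hP.sum_mem (t := Finset.univ)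
    (w := ![(l : ℝ) / (l + m + n), (m : ℝ) / (l + m + n), (n : ℝ) / (l + m + n)])
    (z := ![toPlane p, toPlane q, toPlane r])
    (by intro j _; fin_cases j <;> simp <;> positivity)
    (by simp [Fin.sum_univ_three]; field_simp)
    (by intro j _; fin_cases j <;> simpa)
  convert key using 1
  ext j
  have hj : ((l : ℝ) + m + n) * w j = l * p j + m * q j + n * r j := by exact_mod_cast h j
  simp only [Fin.sum_univ_three, toPlane, Pi.add_apply, Pi.smul_apply, smul_eq_mul,
    Matrix.cons_val_zero, Matrix.cons_val_one, Matrix.cons_val]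
  field_simp
  linarith

/-- The lattice points of a planar set, as a set of pairs. -/
def latticePairs (P : Set (Fin 2 → ℝ)) : Set (ℤ × ℤ) := finTwoArrowEquiv ℤ '' latticePoints P

theorem mem_latticePairs {P : Set (Fin 2 → ℝ)} {p : ℤ × ℤ} :
    p ∈ latticePairs P ↔ toPlane ![p.1, p.2] ∈ P := by
  constructor
  · rintro ⟨v, hv, rfl⟩
    rw [latticePoints, Set.mem_ofPred_eq] at hv
    convert hv using 2
    exact (finTwoArrowEquiv ℤ).symm_apply_apply v
  · intro h
    exact ⟨![p.1, p.2], h, by simp⟩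

theorem ncard_latticePairs (P : Set (Fin 2 → ℝ)) :
    (latticePairs P).ncard = (latticePoints P).ncard :=
  Set.ncard_image_of_injective _ (finTwoArrowEquiv ℤ).injective

theorem triangleClosed_of_convex {P : Set (Fin 2 → ℝ)} (hP : Convex ℝ P) {S : Finset (ℤ × ℤ)}
    (hS : (S : Set (ℤ × ℤ)) = latticePairs P) : TriangleClosed S := by
  have mem : ∀ p, p ∈ S ↔ toPlane ![p.1, p.2] ∈ P := fun p => by
    rw [← mem_latticePairs, ← hS, Finset.mem_coe]
  intro p hp q hq r hr l m n hl hm hn hpos w h1 h2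
  rw [mem] at *
  refine toPlane_mem_of_weights hP hp hq hr hl hm hn hpos fun j => ?_
  fin_cases j
  · exact h1
  · exact h2

theorem convex_P7 (i : Fin 22) : Convex ℝ (P7 i) := convex_convexHull ℝ _

theorem vertices7_mem_box :
    ∀ i : Fin 22, ∀ c ∈ vertices7 i, -2 ≤ c 0 ∧ c 0 ≤ 6 ∧ -1 ≤ c 1 ∧ c 1 ≤ 2 := by
  decide +kernel

/-- A point off the list is excluded by a linear form that is larger there than at all vertices;
coefficients up to 5 suffice. -/
theorem pts7_or_separated :
    ∀ i : Fin 22, ∀ x ∈ Finset.Icc (-2 : ℤ) 6, ∀ y ∈ Finset.Icc (-1 : ℤ) 2, (x, y) ∈ pts7 i ∨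
      ∃ α ∈ intRange 5, ∃ β ∈ intRange 5, ∀ c ∈ vertices7 i, α * c 0 + β * c 1 < α * x + β * y := by
  decide +kernel

/-- The segment at index `0` has no triangle of positive area and needs the second alternative; its
lattice length 6 accounts for `List.range 7`. -/
theorem pts7_mem_triangle_or_segment :
    ∀ i : Fin 22, ∀ p ∈ pts7 i,
      (∃ a ∈ vertices7 i, ∃ b ∈ vertices7 i, ∃ c ∈ vertices7 i,
        0 ≤ area p (b 0, b 1) (c 0, c 1) ∧ 0 ≤ area (a 0, a 1) p (c 0, c 1) ∧
          0 < area (a 0, a 1) (b 0, b 1) p) ∨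
      ∃ a ∈ vertices7 i, ∃ b ∈ vertices7 i, ∃ l ∈ List.range 7, ∃ m ∈ List.range 7,
        0 < l + m ∧ ((l : ℤ) + m) * p.1 = l * a 0 + m * b 0 ∧
          ((l : ℤ) + m) * p.2 = l * a 1 + m * b 1 := by
  decide +kernel

theorem vertices7_subset {i : Fin 22} {c : Fin 2 → ℤ} (hc : c ∈ vertices7 i) :
    toPlane c ∈ P7 i := subset_convexHull ℝ _ ⟨c, hc, rfl⟩

theorem latticePairs_P7 (i : Fin 22) : latticePairs (P7 i) = (pts7 i).toFinset := by
  ext p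
  rw [mem_latticePairs, Finset.mem_coe, List.mem_toFinset]
  constructor
  · intro h
    have bound : ∀ α β m : ℤ, (∀ c ∈ vertices7 i, α * c 0 + β * c 1 ≤ m) →
        α * p.1 + β * p.2 ≤ m := fun α β m hV => by
      simpa using le_of_mem_convexHull hV h
    have hbox := vertices7_mem_box i
    have b1 := bound (-1) 0 2 fun c hc => by linarith [hbox c hc]
    have b2 := bound 1 0 6 fun c hc => by linarith [hbox c hc]
    have b3 := bound 0 (-1) 1 fun c hc => by linarith [hbox c hc]
    have b4 := bound 0 1 2 fun c hc => by linarith [hbox c hc]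
    rcases pts7_or_separated i p.1 (Finset.mem_Icc.mpr ⟨by linarith, by linarith⟩) p.2
      (Finset.mem_Icc.mpr ⟨by linarith, by linarith⟩) with hp | ⟨α, -, β, -, hsep⟩
    · exact hp
    -- Over ℤ the strict separation at the vertices allows a bound that is smaller by one.
    · have := bound α β (α * p.1 + β * p.2 - 1) fun c hc => by linarith [hsep c hc]
      linarith
  · intro h
    rcases pts7_mem_triangle_or_segment i p h with
      ⟨a, ha, b, hb, c, hc, h1, h2, h3⟩ | ⟨a, ha, b, hb, l, -, m, -, hlm, h1, h2⟩
    · refine toPlane_mem_of_weights (convex_P7 i) (vertices7_subset ha) (vertices7_subset hb)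
        (vertices7_subset hc) h1 h2 h3.le (by linarith) fun j => ?_
      fin_cases j <;> simp [area] <;> ring
    · refine toPlane_mem_of_weights (convex_P7 i) (vertices7_subset ha) (vertices7_subset hb)
        (vertices7_subset hb) (l := l) (m := m) (n := 0) (by positivity) (by positivity) le_rfl
        (by exact_mod_cast hlm) fun j => ?_
      fin_cases j <;> simp [h1, h2]

theorem card_pts7 : ∀ i : Fin 22, (pts7 i).toFinset.card = 7 := by decide +kernel

theorem ncard_latticePoints_P7 (i : Fin 22) : (latticePoints (P7 i)).ncard = 7 := by
  rw [← ncard_latticePairs, latticePairs_P7, Set.ncard_coe_finset, card_pts7]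

theorem isLatticePolygon_P7 (i : Fin 22) : IsLatticePolygon (P7 i) := by
  refine ⟨vertices7 i, ?_, rfl⟩
  revert i
  decide +kernel

/-! ### From lattice points back to polygons -/

/-- The generating points are lattice points of `P`, and `P` is convex. Hence a map that matches
lattice points also matches the polygons. -/
theorem IsLatticePolygon.eq_convexHull {P : Set (Fin 2 → ℝ)} (hP : IsLatticePolygon P) :
    P = convexHull ℝ (toPlane '' latticePoints P) := by
  obtain ⟨S, -, rfl⟩ := hP
  refine Set.Subset.antisymm (convexHull_mono ?_) (convexHull_min ?_ (convex_convexHull ℝ _))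
  · exact Set.image_mono fun v hv => subset_convexHull ℝ _ ⟨v, hv, rfl⟩
  · rintro _ ⟨v, hv, rfl⟩
    exact hv

namespace UnimodularMap

/-- The linear part of an affine unimodular map. -/
def matrix (f : UnimodularMap) : Matrix (Fin 2) (Fin 2) ℤ := !![f.a, f.b; f.c, f.d]

/-- The extension of an affine unimodular map to the plane. -/
noncomputable def plane (f : UnimodularMap) : (Fin 2 → ℝ) →ᵃ[ℝ] (Fin 2 → ℝ) :=
  (f.matrix.map (Int.cast : ℤ → ℝ)).mulVecLin.toAffineMap +
    AffineMap.const ℝ _ (toPlane ![f.s, f.t])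

theorem coe_plane (f : UnimodularMap) : ⇑f.plane = fun x : Fin 2 → ℝ =>
    (f.matrix.map (Int.cast : ℤ → ℝ)).mulVec x + toPlane ![f.s, f.t] := by
  ext x j
  simp [plane]

theorem plane_toPlane (f : UnimodularMap) (p : ℤ × ℤ) :
    f.plane (toPlane ![p.1, p.2]) = toPlane ![(f.app p).1, (f.app p).2] := by
  ext j
  fin_cases j <;>
    simp [coe_plane, matrix, toPlane, app]

theorem latticeEquivalent_iff {P Q : Set (Fin 2 → ℝ)} :
    LatticeEquivalent P Q ↔ ∃ f : UnimodularMap, f.plane '' P = Q := by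
  constructor
  · rintro ⟨M, t, hM, h⟩
    rw [Matrix.det_fin_two] at hM
    refine ⟨⟨M 0 0, M 0 1, M 1 0, M 1 1, t 0, t 1, hM⟩, ?_⟩
    rw [coe_plane, ← h]
    congr 1
    ext x j
    fin_cases j <;> simp [matrix, toPlane]
  · rintro ⟨f, h⟩
    refine ⟨f.matrix, ![f.s, f.t], ?_, by rwa [coe_plane] at h⟩
    rw [matrix, Matrix.det_fin_two_of]
    exact f.det_eq

end UnimodularMap

theorem image_toPlane_latticePoints (P : Set (Fin 2 → ℝ)) :
    toPlane '' latticePoints P = (fun p : ℤ × ℤ => toPlane ![p.1, p.2]) '' latticePairs P := by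
  rw [latticePairs, Set.image_image]
  refine Set.image_congr fun v _ => ?_
  congr 1
  exact ((finTwoArrowEquiv ℤ).symm_apply_apply v).symm

theorem IsLatticePolygon.image_plane {P Q : Set (Fin 2 → ℝ)} (hP : IsLatticePolygon P)
    (hQ : IsLatticePolygon Q) (f : UnimodularMap) (h : f.app '' latticePairs P = latticePairs Q) :
    f.plane '' P = Q := by
  rw [hP.eq_convexHull, hQ.eq_convexHull, AffineMap.image_convexHull, image_toPlane_latticePoints,
    image_toPlane_latticePoints, ← h, Set.image_image, Set.image_image]
  congr 1
  exact Set.image_congr fun p _ => f.plane_toPlane p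

theorem exists_app_image_latticePairs {P : Set (Fin 2 → ℝ)} (hP : IsLatticePolygon P)
    (h7 : (latticePoints P).ncard = 7) :
    ∃ (i : Fin 22) (f : UnimodularMap), f.app '' latticePairs P = latticePairs (P7 i) := by
  rw [← ncard_latticePairs] at h7
  have hfin : (latticePairs P).Finite := Set.finite_of_ncard_ne_zero (by omega)
  have hconv : Convex ℝ P := by
    obtain ⟨S, -, rfl⟩ := hP
    exact convex_convexHull ℝ _
  obtain ⟨i, f, hf⟩ := exists_uequiv_pts7 (triangleClosed_of_convex hconv hfin.coe_toFinset)
    (by rw [← Set.ncard_eq_toFinset_card _ hfin, h7])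
  refine ⟨i, f, ?_⟩
  rw [latticePairs_P7, ← hf, Finset.coe_image, hfin.coe_toFinset]

/-! ### Pairwise inequivalence -/

/-- An invariant of finite sets of lattice points under unimodular equivalence. -/
def areaInvariant (S : Finset (ℤ × ℤ)) : ℕ :=
  ∑ p ∈ S, (∑ q ∈ S, ∑ r ∈ S, (area p q r).natAbs) ^ 2

theorem UEquiv.areaInvariant_eq {S T : Finset (ℤ × ℤ)} (h : UEquiv S T) :
    areaInvariant S = areaInvariant T := by
  obtain ⟨f, rfl⟩ := h
  simp only [areaInvariant, Finset.sum_image f.app_injective.injOn, f.area_app]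

/-- The squares record how the area is distributed over the points, and this already gives 22
different values. -/
theorem areaInvariant_pts7_injective :
    ∀ i j : Fin 22, areaInvariant (pts7 i).toFinset = areaInvariant (pts7 j).toFinset → i = j := by
  decide +kernel

theorem eq_of_latticeEquivalent_P7 {i j : Fin 22} (h : LatticeEquivalent (P7 i) (P7 j)) :
    i = j := by
  obtain ⟨f, hf⟩ := UnimodularMap.latticeEquivalent_iff.mp h
  refine areaInvariant_pts7_injective i j (UEquiv.areaInvariant_eq (UEquiv.of_subset f ?_ ?_))
  · intro p hp
    rw [← Finset.mem_coe, ← latticePairs_P7, mem_latticePairs] at hp ⊢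
    rw [← hf, ← f.plane_toPlane]
    exact Set.mem_image_of_mem _ hp
  · rw [card_pts7, card_pts7]

/-! ### Toric codes -/

/-- The character of the torus given by a Laurent monomial. -/
def monomialChar (F : Type*) [Field F] (p : Fin 2 → ℤ) : (Fin 2 → Fˣ) →* F where
  toFun := monomialRow F p
  map_one' := by simp [monomialRow]
  map_mul' a b := by
    simp only [monomialRow, Pi.mul_apply, mul_zpow, Units.val_mul]
    ring

theorem latticePoint_bounds {q : ℕ} {P : Set (Fin 2 → ℝ)} (hP : P ⊆ square q) {p : Fin 2 → ℤ}
    (hp : p ∈ latticePoints P) (j : Fin 2) : 0 ≤ p j ∧ p j < (q : ℤ) - 1 := by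
  obtain ⟨h1, h2⟩ := hP hp j
  simp only [toPlane] at h1 h2
  have h3 : p j ≤ (q : ℤ) - 2 := by exact_mod_cast h2
  exact ⟨by exact_mod_cast h1, by linarith⟩

theorem finite_latticePoints {q : ℕ} {P : Set (Fin 2 → ℝ)} (hP : P ⊆ square q) :
    (latticePoints P).Finite :=
  (Set.finite_Icc (0 : Fin 2 → ℤ) fun _ => (q : ℤ)).subset fun p hp =>
    ⟨fun j => (latticePoint_bounds hP hp j).1, fun j => by
      have := (latticePoint_bounds hP hp j).2; simp only; linarith⟩

section Code

variable {F : Type*} [Field F]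

/-- Evaluation at (g, 1) and (1, g), with `g` a generator of `Fˣ`, recovers the exponents modulo q -
1, and they lie in [0, q - 2]. -/
theorem monomialChar_injOn [Fintype F] {P : Set (Fin 2 → ℝ)} (hP : P ⊆ square (Fintype.card F)) :
    Set.InjOn (monomialChar F) (latticePoints P) := by
  intro p hp p' hp' h
  obtain ⟨g, hg⟩ := IsCyclic.exists_generator (α := Fˣ)
  have hord : (orderOf g : ℤ) = (Fintype.card F : ℤ) - 1 := by
    rw [orderOf_eq_card_of_forall_mem_zpowers hg, Nat.card_units, Nat.card_eq_fintype_card,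
      Nat.cast_sub Fintype.card_pos, Nat.cast_one]
  have key : ∀ j, g ^ p j = g ^ p' j → p j = p' j := by
    intro j hj
    rw [zpow_eq_zpow_iff_modEq, hord] at hj
    obtain ⟨h1, h2⟩ := latticePoint_bounds hP hp j
    obtain ⟨h3, h4⟩ := latticePoint_bounds hP hp' j
    rwa [Int.ModEq, Int.emod_eq_of_lt h1 h2, Int.emod_eq_of_lt h3 h4] at hj
  have hval : ∀ a, monomialRow F p a = monomialRow F p' a := fun a => DFunLike.congr_fun h a
  ext j
  apply key
  fin_cases j
  · simpa [monomialRow, -Units.val_zpow_eq_zpow_val, Units.val_inj] using hval ![g, 1]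
  · simpa [monomialRow, -Units.val_zpow_eq_zpow_val, Units.val_inj] using hval ![1, g]

/-- Distinct characters are linearly independent (Dedekind). -/
theorem finrank_toricCode [Fintype F] {P : Set (Fin 2 → ℝ)} (hP : P ⊆ square (Fintype.card F)) :
    Module.finrank F (toricCode F P) = (latticePoints P).ncard := by
  have : Fintype (latticePoints P) := (finite_latticePoints hP).fintype
  have hli : LinearIndependent F fun p : latticePoints P => monomialRow F p.1 :=
    (linearIndependent_monoidHom (Fin 2 → Fˣ) F).comp
      (fun p : latticePoints P => monomialChar F p.1) (monomialChar_injOn hP).injective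
  rw [toricCode, Set.image_eq_range, finrank_span_eq_card hli, ← Nat.card_eq_fintype_card,
    Nat.card_coe_set_eq]

/-- A linear isomorphism that permutes and rescales the coordinates takes a code to a monomially
equivalent one. -/
theorem monomiallyEquivalent_of_map {ι : Type*} [Fintype ι] [DecidableEq ι]
    {C₁ C₂ : Submodule F (ι → F)} (d : ι → Fˣ) (φ : Equiv.Perm ι)
    (ψ : (ι → F) →ₗ[F] (ι → F)) (hψ : ∀ h a, ψ h a = d a * h (φ a)) (hC : C₁.map ψ = C₂) :
    MonomiallyEquivalent C₁ C₂ := by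
  let B := Module.finBasis F C₁
  have hinj : Function.Injective ψ := by
    intro h h' e
    ext a
    have := congrFun e (φ.symm a)
    rw [hψ, hψ, φ.apply_symm_apply] at this
    exact mul_left_cancel₀ (Units.ne_zero _) this
  have hspan : Submodule.span F (Set.range fun i => (B i : ι → F)) = C₁ := by
    have := congrArg (Submodule.map C₁.subtype) B.span_eq
    rwa [Submodule.map_span, Submodule.map_subtype_top, ← Set.range_comp] at this
  have hli : LinearIndependent F fun i => (B i : ι → F) :=
    B.linearIndependent.map' C₁.subtype (Submodule.ker_subtype C₁)
  -- Right multiplication by the matrix of `π` moves column `π.symm a` to place `a`. So `π` is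
  -- `φ.symm`, and the scaling, applied before the permutation, is reindexed by `φ.symm`.
  refine ⟨_, Matrix.of fun i => (B i : ι → F), Matrix.of fun i => ψ (B i), fun a => d (φ.symm a), φ.symm,
    ⟨hli, hspan⟩, ⟨hli.map' ψ (LinearMap.ker_eq_bot.mpr hinj), ?_⟩, ?_⟩
  · have := congrArg (Submodule.map ψ) hspan
    rw [Submodule.map_span, ← Set.range_comp] at this
    exact this.trans hC
  · ext i a
    rw [Equiv.Perm.permMatrix, PEquiv.mul_toMatrix_toPEquiv]
    simp [Matrix.mul_diagonal, hψ, mul_comm]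

end Code

namespace UnimodularMap

variable {F : Type*} [Field F]

/-- The endomorphism of the torus that is dual to the linear part of an affine unimodular map. -/
def torusMap (f : UnimodularMap) (x : Fin 2 → Fˣ) : Fin 2 → Fˣ :=
  ![x 0 ^ f.a * x 1 ^ f.c, x 0 ^ f.b * x 1 ^ f.d]

/-- The exponents of the adjugate undo the map up to raising to the power of the determinant ±1,
which is injective. -/
theorem torusMap_injective (f : UnimodularMap) :
    Function.Injective (f.torusMap : (Fin 2 → Fˣ) → Fin 2 → Fˣ) := by
  have inv : ∀ x : Fin 2 → Fˣ,
      (f.torusMap x 0) ^ f.d * (f.torusMap x 1) ^ (-f.c) = x 0 ^ (f.a * f.d - f.b * f.c) ∧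
      (f.torusMap x 0) ^ (-f.b) * (f.torusMap x 1) ^ f.a = x 1 ^ (f.a * f.d - f.b * f.c) := by
    intro x
    simp only [torusMap, Matrix.cons_val_zero, Matrix.cons_val_one, mul_zpow, ← zpow_mul]
    constructor
    · rw [mul_mul_mul_comm, ← zpow_add, ← zpow_add]
      have h : f.c * f.d + f.d * -f.c = 0 := by ring
      rw [h, zpow_zero, mul_one]
      congr 1
      ring
    · rw [mul_mul_mul_comm, ← zpow_add, ← zpow_add]
      have h : f.a * -f.b + f.b * f.a = 0 := by ring
      rw [h, zpow_zero, one_mul]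
      congr 1
      ring
  have hcancel : ∀ u v : Fˣ,
      u ^ (f.a * f.d - f.b * f.c) = v ^ (f.a * f.d - f.b * f.c) → u = v := by
    intro u v h
    rcases f.det_eq with e | e <;> rw [e] at h
    · simpa using h
    · simpa using h
  intro x y h
  ext j : 1
  apply hcancel
  fin_cases j
  · exact (inv x).1.symm.trans ((by rw [h] : _ = _).trans (inv y).1)
  · exact (inv x).2.symm.trans ((by rw [h] : _ = _).trans (inv y).2)

/-- The transpose of the linear part acts on the torus; the translation becomes a factor that does
not depend on `p`. -/
theorem monomialRow_app (f : UnimodularMap) (p : ℤ × ℤ) (x : Fin 2 → Fˣ) :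
    monomialRow F ![(f.app p).1, (f.app p).2] x =
      ((x 0 ^ f.s * x 1 ^ f.t : Fˣ) : F) * monomialRow F ![p.1, p.2] (f.torusMap x) := by
  simp only [monomialRow, ← Units.val_mul]
  congr 1
  simp only [app, torusMap, Matrix.cons_val_zero, Matrix.cons_val_one, mul_zpow, ← zpow_mul,
    zpow_add]
  simp only [mul_comm, mul_left_comm, mul_assoc]

end UnimodularMap

theorem image_monomialRow (F : Type*) [Field F] (P : Set (Fin 2 → ℝ)) :
    monomialRow F '' latticePoints P =
      (fun p : ℤ × ℤ => monomialRow F ![p.1, p.2]) '' latticePairs P := by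
  rw [latticePairs, Set.image_image]
  refine Set.image_congr fun v _ => ?_
  congr 1
  exact ((finTwoArrowEquiv ℤ).symm_apply_apply v).symm

/-- Negative exponents make sense on the torus, so neither polygon has to lie in the square; this
matters for the polygons `P7 i`. -/
theorem monomiallyEquivalent_toricCode (F : Type*) [Field F] [Fintype F] [DecidableEq F]
    {P Q : Set (Fin 2 → ℝ)} (f : UnimodularMap) (h : f.app '' latticePairs P = latticePairs Q) :
    MonomiallyEquivalent (toricCode F P) (toricCode F Q) := by
  let φ : Equiv.Perm (Fin 2 → Fˣ) :=
    Equiv.ofBijective f.torusMap (Finite.injective_iff_bijective.mp f.torusMap_injective)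
  let d : (Fin 2 → Fˣ) → Fˣ := fun x => x 0 ^ f.s * x 1 ^ f.t
  let ψ : ((Fin 2 → Fˣ) → F) →ₗ[F] ((Fin 2 → Fˣ) → F) :=
    { toFun := fun r x => d x * r (φ x)
      map_add' := fun r r' => by ext x; simp [mul_add]
      map_smul' := fun c r => by ext x; simp [mul_left_comm] }
  refine monomiallyEquivalent_of_map d φ ψ (fun _ _ => rfl) ?_
  rw [toricCode, toricCode, Submodule.map_span, image_monomialRow, image_monomialRow, ← h,
    Set.image_image, Set.image_image]
  congr 1
  refine Set.image_congr fun p _ => ?_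
  ext x
  exact (f.monomialRow_app p x).symm

theorem theorem1p1 :
    -- the 22 polygons have exactly seven lattice points and are pairwise lattice inequivalent
    (∀ i : Fin 22, (latticePoints (P7 i)).ncard = 7) ∧
    (∀ i j : Fin 22, LatticeEquivalent (P7 i) (P7 j) → i = j) ∧
    -- every lattice polygon with exactly seven lattice points is equivalent to one of them
    (∀ P : Set (Fin 2 → ℝ), IsLatticePolygon P → (latticePoints P).ncard = 7 →
      ∃ i : Fin 22, LatticeEquivalent P (P7 i)) ∧
    -- every toric surface code of dimension seven is monomially equivalent to one of their codes
    (∀ (F : Type*) [Field F] [Fintype F] [DecidableEq F] (P : Set (Fin 2 → ℝ)),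
      IsLatticePolygon P → P ⊆ square (Fintype.card F) →
      Module.finrank F (toricCode F P) = 7 →
      ∃ i : Fin 22, MonomiallyEquivalent (toricCode F P) (toricCode F (P7 i))) := by
  refine ⟨ncard_latticePoints_P7, fun i j => eq_of_latticeEquivalent_P7, fun P hP h7 => ?_,
    fun F _ _ _ P hP hsq h7 => ?_⟩
  · obtain ⟨i, f, hf⟩ := exists_app_image_latticePairs hP h7
    exact ⟨i, UnimodularMap.latticeEquivalent_iff.mpr
      ⟨f, hP.image_plane (isLatticePolygon_P7 i) f hf⟩⟩
  · rw [finrank_toricCode hsq] at h7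
    obtain ⟨i, f, hf⟩ := exists_app_image_latticePairs hP h7
    exact ⟨i, monomiallyEquivalent_toricCode F f hf⟩
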